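/- **Setting.** Let $(W,\mathcal S)$ be a finite Coxeter system of rank $n$ and let $\Delta=\{\alpha_s : s\in\mathcal S\}\subseteq\Phi^+\subseteq\Phi=W(\Delta)\subseteq V$ be a finite (reduced, not necessarily crystallographic) root system for $(W,\mathcal S)$ in a Euclidean vector space $V$ with basis $\Delta$, where $W$ acts faithfully and $s\in\mathcal S$ acts as the orthogonal reflection along the simple root $\alpha_s$. Let $N=|\Phi^+|$, let $(a_{st})$ be the Cartan matrix, $s(\alpha_t)=\alpha_t-a_{st}\alpha_s$, and let $\omega_s$, $s\in\mathcal S$, be the fundamental weights, given by $\alpha_s=\sum_{t}a_{ts}\omega_t$. Let $w_\circ$ be the longest element of $W$, let $\mathrm c=s_1\cdots s_n$ be a reduced word of a Coxeter element (each element of $\mathcal S$ appears exactly once), let $\mathrm c(w_\circ)$ be the $\mathrm c$-sorting word, i.e. the lexicographically first subword of $\mathrm c^N$ that is a reduced word for $w_\circ$, and let $Q=\mathrm c\,\mathrm c(w_\circ)=q_1\cdots q_{n+N}$. A *facet* (of the subword complex of $Q$) is a set $I\subseteq\{1,\dots,n+N\}$ of positions whose complement in $Q$ is a reduced word for $w_\circ$;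 let $I_g$ and $I_{ag}$ be the lexicographically first and last facets (as sorted lists). For a facet $I$ and a position $k$ put $$r(I,k)=\Big(\prod_{j<k,\ j\notin I}q_j\Big)(\alpha_{q_k}),\qquad w(I,k)=\Big(\prod_{j<k,\ j\notin I}q_j\Big)(\omega_{q_k}),$$ with the products in the order of $Q$. The map $k\mapsto r(I_g,k)$ is a bijection from $\{n+1,\dots,n+N\}$ to $\Phi^+$; for $\beta=r(I_g,k)\in\Phi^+$ with $k>n$ write $w(I,\beta)=w(I,k)$. For $\beta\in\Phi^+$ and $X\subseteq\Phi^+$ define $$\mathsf{Asso}_\beta=\operatorname{conv}\{w(I,\beta)-w(I_{ag},\beta) : I\text{ facet}\},\qquad \mathsf b_X(I)=\sum_{\beta\in X}\big(w(I,\beta)-w(I_{ag},\beta)\big),\qquad \mathsf{Asso}_X=\operatorname{conv}\{\mathsf b_X(I) : I\text{ facet}\}.$$ **Proposition.** For every set $X\subseteq\Phi^+$ of positive roots, $\mathsf{Asso}_X$ is the Minkowski sum $$\mathsf{Asso}_X=\sum_{\beta\in X}\mathsf{Asso}_\beta,$$ and the set of vertices of $\mathsf{Asso}_X$ is $\{\mathsf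 b_X(I) : I\text{ facet}\}$. -/

import Mathlib

open scoped Pointwise

/-- A finite root system for the finite Coxeter system `(W, S)` inside the Euclidean space `V`:
a basis of `V` of simple roots `α_s`, `s ∈ S`, such that `W` acts faithfully on `V` with each
`s ∈ S` acting as the orthogonal reflection along `α_s`, and such that the set `Φ = W(Δ)` of roots
is reduced and each root is a nonnegative or a nonpositive combination of simple roots.
(No integrality is required, so that the noncrystallographic types are included.) -/
structure CoxeterRootSystem {S W : Type*} [Group W] {M : CoxeterMatrix S}
    (cs : CoxeterSystem M W) (V : Type*) [NormedAddCommGroup V] [InnerProductSpace ℝ V] where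
  /-- the simple roots `α_s`, which form a basis of `V` -/
  simpleRoot : Module.Basis S ℝ V
  /-- the action of `W` on `V` -/
  rep : Representation ℝ W V
  rep_simple : ∀ (s : S) (v : V), rep (cs.simple s) v =
    v - (2 * inner ℝ (simpleRoot s) v / inner ℝ (simpleRoot s) (simpleRoot s)) • simpleRoot s
  rep_injective : Function.Injective rep
  reduced : ∀ (w w' : W) (s s' : S) (a : ℝ),
    rep w (simpleRoot s) = a • rep w' (simpleRoot s') → a = 1 ∨ a = -1
  nonneg_or_nonpos : ∀ (w : W) (s : S),
    (∀ t, 0 ≤ simpleRoot.repr (rep w (simpleRoot s)) t) ∨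
      (∀ t, simpleRoot.repr (rep w (simpleRoot s)) t ≤ 0)

/-- A word in the simple reflections in which each of them appears exactly once, that is, a
reduced word of a (standard) Coxeter element. -/
def IsCoxeterWord {S : Type*} (c : List S) : Prop :=
  c.Nodup ∧ ∀ s, s ∈ c

/-- The subword of `Q` formed by the letters at the positions in `J`, in the order of `Q`
(positions are counted from `0`). -/
noncomputable def subwordAt {S : Type*} (Q : List S) (J : Finset (Fin Q.length)) : List S :=
  (J.sort (· ≤ ·)).map Q.get

/-- The lexicographically first one among the finite sets of positions with property `P`, each
written as a sorted list; an arbitrary set if none has the property. -/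
noncomputable def lexFirst {m : ℕ} (P : Finset (Fin m) → Prop) : Finset (Fin m) :=
  Classical.epsilon fun I => P I ∧ ∀ J, P J → I.sort (· ≤ ·) ≤ J.sort (· ≤ ·)

/-- The lexicographically last one among the finite sets of positions with property `P`, each
written as a sorted list; an arbitrary set if none has the property. -/
noncomputable def lexLast {m : ℕ} (P : Finset (Fin m) → Prop) : Finset (Fin m) :=
  Classical.epsilon fun I => P I ∧ ∀ J, P J → J.sort (· ≤ ·) ≤ I.sort (· ≤ ·)

namespace CoxeterSystem

variable {S W : Type*} [Group W] {M : CoxeterMatrix S} (cs : CoxeterSystem M W)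

/-- The longest element `w₀` of a finite Coxeter group. -/
noncomputable def longest [Finite W] : W :=
  Classical.choose (Finite.exists_max cs.length)

/-- The word `ω` is a reduced word for `w₀`. -/
def IsReducedWordOfLongest [Finite W] (ω : List S) : Prop :=
  cs.IsReduced ω ∧ cs.wordProd ω = cs.longest

/-- The facets of the spherical subword complex of `Q`: the sets of positions in `Q` whose
complement is (the set of positions of) a reduced word for `w₀`. -/
def IsFacet [Finite W] (Q : List S) (I : Finset (Fin Q.length)) : Prop :=
  cs.IsReducedWordOfLongest (subwordAt Q Iᶜ)

/-- The greedy facet of the subword complex of `Q`: the lexicographically first one. -/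
noncomputable def greedy [Finite W] (Q : List S) : Finset (Fin Q.length) :=
  lexFirst (cs.IsFacet Q)

/-- The antigreedy facet of the subword complex of `Q`: the lexicographically last one. -/
noncomputable def antigreedy [Finite W] (Q : List S) : Finset (Fin Q.length) :=
  lexLast (cs.IsFacet Q)

end CoxeterSystem

namespace CoxeterRootSystem

variable {S W : Type*} [Group W] {M : CoxeterMatrix S} {cs : CoxeterSystem M W}
  {V : Type*} [NormedAddCommGroup V] [InnerProductSpace ℝ V] (R : CoxeterRootSystem cs V)

/-- The set of roots `Φ = W(Δ)`. -/
def roots : Set V := {β | ∃ (w : W) (s : S), β = R.rep w (R.simpleRoot s)}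

/-- The set `Φ⁺` of positive roots: the roots that are nonnegative combinations of simple roots. -/
def positiveRoots : Set V := {β ∈ R.roots | ∀ t, 0 ≤ R.simpleRoot.repr β t}

/-- The Cartan matrix `(a_{st})`, given by `s(α_t) = α_t - a_{st} α_s`. -/
noncomputable def cartan (s t : S) : ℝ :=
  2 * inner ℝ (R.simpleRoot s) (R.simpleRoot t) / inner ℝ (R.simpleRoot s) (R.simpleRoot s)

theorem rep_simple_simpleRoot (s t : S) :
    R.rep (cs.simple s) (R.simpleRoot t) = R.simpleRoot t - R.cartan s t • R.simpleRoot s :=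
  R.rep_simple s _

/-- The fundamental weight `ω_s`: the vector with `⟨ω_s, α_s⟩ = ⟨α_s, α_s⟩ / 2` that is orthogonal
to the other simple roots. See `simpleRoot_eq_sum` for its description by the Cartan matrix. -/
noncomputable def weight [Fintype S] (s : S) : V :=
  haveI : FiniteDimensional ℝ V := R.simpleRoot.finiteDimensional_of_finite
  haveI : CompleteSpace V := FiniteDimensional.complete ℝ V
  (inner ℝ (R.simpleRoot s) (R.simpleRoot s) / 2) •
    (InnerProductSpace.toDual ℝ V).symm (LinearMap.toContinuousLinearMap (R.simpleRoot.coord s))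

theorem inner_weight [Fintype S] [DecidableEq S] (s t : S) :
    inner ℝ (R.weight s) (R.simpleRoot t) =
      if s = t then inner ℝ (R.simpleRoot s) (R.simpleRoot s) / 2 else 0 := by
  have : FiniteDimensional ℝ V := R.simpleRoot.finiteDimensional_of_finite
  have : CompleteSpace V := FiniteDimensional.complete ℝ V
  unfold weight
  rw [real_inner_smul_left, InnerProductSpace.toDual_symm_apply]
  simp [Finsupp.single_apply, eq_comm]

/-- The defining relation `α_s = ∑_t a_{ts} ω_t` of the fundamental weights. -/
theorem simpleRoot_eq_sum [Fintype S] (s : S) :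
    R.simpleRoot s = ∑ t, R.cartan t s • R.weight t := by
  classical
  refine InnerProductSpace.ext_inner_right_basis R.simpleRoot fun r => ?_
  have h : inner ℝ (R.simpleRoot r) (R.simpleRoot r) ≠ 0 :=
    inner_self_ne_zero.2 (R.simpleRoot.ne_zero r)
  rw [sum_inner]
  simp only [real_inner_smul_left, inner_weight, cartan]
  rw [Finset.sum_eq_single r (fun t _ ht => by rw [if_neg ht, mul_zero]) (by simp), if_pos rfl,
    real_inner_comm]
  field_simp

/-- The `c`-sorting word `c(w₀)`: the lexicographically first subword of `c^N`, with `N = |Φ⁺|`,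
that is a reduced word for `w₀`. -/
noncomputable def sortingWord [Finite W] (c : List S) : List S :=
  subwordAt (List.replicate R.positiveRoots.ncard c).flatten
    (lexFirst fun J => cs.IsReducedWordOfLongest (subwordAt _ J))

/-- The word `c c(w₀)`. -/
noncomputable def word [Finite W] (c : List S) : List S := c ++ R.sortingWord c

/-- The root function `r(I, k) = ∏Q_{[k-1] ∖ I} (α_{q_k})` of a set `I` of positions in `Q`. -/
noncomputable def rootFunction (Q : List S) (I : Finset (Fin Q.length)) (k : Fin Q.length) : V :=
  R.rep (cs.wordProd (subwordAt Q (Finset.univ.filter (· < k) \ I))) (R.simpleRoot (Q.get k))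

/-- The weight function `w(I, k) = ∏Q_{[k-1] ∖ I} (ω_{q_k})` of a set `I` of positions in `Q`. -/
noncomputable def weightFunction [Fintype S] (Q : List S) (I : Finset (Fin Q.length))
    (k : Fin Q.length) : V :=
  R.rep (cs.wordProd (subwordAt Q (Finset.univ.filter (· < k) \ I))) (R.weight (Q.get k))

open Classical in
/-- The shifted weight `w(I, β) - w(I_antigreedy, β)` for a positive root `β`, where `w(I, β)` is
`w(I, k)` for the position `k` in the part `c(w₀)` of `Q = c c(w₀)` with `r(I_greedy, k) = β`.
The root function of the greedy facet is a bijection from these positions to the positive roots;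
the value is `0` if `β` is not a positive root. -/
noncomputable def shiftedWeight [Fintype S] [Finite W] (c : List S)
    (I : Finset (Fin (R.word c).length)) (β : V) : V :=
  if h : ∃ k : Fin (R.word c).length,
      c.length ≤ k ∧ R.rootFunction (R.word c) (cs.greedy (R.word c)) k = β then
    R.weightFunction (R.word c) I h.choose -
      R.weightFunction (R.word c) (cs.antigreedy (R.word c)) h.choose
  else 0

/-- The polytope `Asso_β(M_c)` of a positive root `β`. -/
noncomputable def assoRoot [Fintype S] [Finite W] (c : List S) (β : V) : Set V :=
  convexHull ℝ {v | ∃ I, cs.IsFacet (R.word c) I ∧ v = R.shiftedWeight c I β}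

/-- The partial brick vector `b_X(I) = ∑_{β ∈ X} (w(I, β) - w(I_antigreedy, β))`. -/
noncomputable def partialBrickVector [Fintype S] [Finite W] (c : List S) (X : Finset V)
    (I : Finset (Fin (R.word c).length)) : V :=
  ∑ β ∈ X, R.shiftedWeight c I β

/-- The polytope `Asso_X(M_c)`: the convex hull of the partial brick vectors of all facets. -/
noncomputable def assoSet [Fintype S] [Finite W] (c : List S) (X : Finset V) : Set V :=
  convexHull ℝ {v | ∃ I, cs.IsFacet (R.word c) I ∧ v = R.partialBrickVector c X I}

end CoxeterRootSystem

/-! The root configuration of a facet `I` is the family of roots `r(I, i)` with `i ∈ I`. A linear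
functional `v` lies in the closed chamber of some `w`. If a root of the configuration is not in
`w(Φ⁺)`, flipping its position adds to every weight `w(I, k)` a nonnegative multiple of a root in
`w(Φ⁺)`, so no pairing with `v` decreases (`exists_flip`). Such flips end at a facet whose
configuration lies in `w(Φ⁺)` (`exists_isGood`), and this facet is unique (`IsGood.unique`). It
therefore maximizes `v` on the weight functions of all positions simultaneously. Hence the support
function of the hull of the sums is the sum of the support functions, which is the Minkowski
identity.

Uniqueness is by induction on `w`: for `w = 1` the facet can be read off from the right end of `Q`,
and passing from `w` to `ws` exchanges only the root `w(α_s)` for its negative, which costs at most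
one flip. This needs linearly independent root configurations. Their span is invariant under flips,
and for the initial copy of `c` the configuration is the set of simple roots; so every configuration
has `n` elements and spans `V`.

Independence also gives the vertices: the functionals positive on the configuration of `I` form a
nonempty open cone, all of them are maximized at `b_X(I)`, and a point maximizing an open set of
functionals is extreme. -/

/-! ### Positive roots, reflections and length. -/

namespace CoxeterRootSystem

variable {S W : Type*} [Group W] {M : CoxeterMatrix S} {cs : CoxeterSystem M W}
  {V : Type*} [NormedAddCommGroup V] [InnerProductSpace ℝ V] (R : CoxeterRootSystem cs V)

/-- The vector `γ` is a nonnegative combination of simple roots. -/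
def IsPos (γ : V) : Prop := ∀ t, 0 ≤ R.simpleRoot.repr γ t

theorem inner_simpleRoot_self_pos (s : S) :
    0 < inner ℝ (R.simpleRoot s) (R.simpleRoot s) :=
  real_inner_self_pos.2 (R.simpleRoot.ne_zero s)

theorem rep_mul_apply (u w : W) (v : V) : R.rep (u * w) v = R.rep u (R.rep w v) := by
  rw [map_mul]; rfl

theorem rep_one_apply (v : V) : R.rep 1 v = v := by
  rw [map_one]; rfl

theorem rep_inv_rep (u : W) (v : V) : R.rep u⁻¹ (R.rep u v) = v := by
  rw [← rep_mul_apply, inv_mul_cancel, rep_one_apply]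

theorem rep_rep_inv (u : W) (v : V) : R.rep u (R.rep u⁻¹ v) = v := by
  rw [← rep_mul_apply, mul_inv_cancel, rep_one_apply]

theorem rep_simple_self (s : S) :
    R.rep (cs.simple s) (R.simpleRoot s) = -R.simpleRoot s := by
  rw [R.rep_simple, mul_div_assoc, div_self (R.inner_simpleRoot_self_pos s).ne', mul_one, two_smul]
  abel

theorem inner_rep_simple (s : S) (x y : V) :
    inner ℝ (R.rep (cs.simple s) x) (R.rep (cs.simple s) y) = inner ℝ x y := by
  have h := (R.inner_simpleRoot_self_pos s).ne'
  simp only [R.rep_simple, inner_sub_left, inner_sub_right, real_inner_smul_left,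
    real_inner_smul_right, real_inner_comm (R.simpleRoot s) x]
  field_simp
  ring

theorem inner_rep (w : W) (x y : V) : inner ℝ (R.rep w x) (R.rep w y) = inner ℝ x y := by
  induction w using cs.simple_induction_left with
  | one => simp only [rep_one_apply]
  | mul_simple_left w s ih => rw [rep_mul_apply, rep_mul_apply, inner_rep_simple, ih]

theorem inner_rep_right (w : W) (x y : V) :
    inner ℝ x (R.rep w y) = inner ℝ (R.rep w⁻¹ x) y := by
  rw [← R.inner_rep w (R.rep w⁻¹ x) y, rep_rep_inv]

theorem rep_simpleRoot_mem (w : W) (s : S) : R.rep w (R.simpleRoot s) ∈ R.roots := ⟨w, s, rfl⟩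

theorem simpleRoot_mem (s : S) : R.simpleRoot s ∈ R.roots := ⟨1, s, (R.rep_one_apply _).symm⟩

variable {R} in
theorem rep_mem_roots {γ : V} (hγ : γ ∈ R.roots) (w : W) : R.rep w γ ∈ R.roots := by
  obtain ⟨u, s, rfl⟩ := hγ
  exact ⟨w * u, s, (R.rep_mul_apply _ _ _).symm⟩

variable {R} in
theorem neg_mem_roots {γ : V} (hγ : γ ∈ R.roots) : -γ ∈ R.roots := by
  obtain ⟨u, s, rfl⟩ := hγ
  exact ⟨u * cs.simple s, s, by rw [rep_mul_apply, rep_simple_self, map_neg]⟩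

variable {R} in
theorem ne_zero_of_mem_roots {γ : V} (hγ : γ ∈ R.roots) : γ ≠ 0 := by
  obtain ⟨u, s, rfl⟩ := hγ
  intro h
  apply R.simpleRoot.ne_zero s
  rw [← R.rep_inv_rep u (R.simpleRoot s), h, map_zero]

variable {R} in
theorem isPos_or_isPos_neg {γ : V} (hγ : γ ∈ R.roots) : R.IsPos γ ∨ R.IsPos (-γ) := by
  obtain ⟨u, s, rfl⟩ := hγ
  refine (R.nonneg_or_nonpos u s).imp id fun h t => ?_
  simpa using h t

variable {R} in
theorem IsPos.not_neg {γ : V} (h : R.IsPos γ) (hγ : γ ∈ R.roots) : ¬R.IsPos (-γ) := by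
  intro h'
  apply ne_zero_of_mem_roots hγ
  apply R.simpleRoot.repr.injective
  ext t
  have := h' t
  simp only [map_neg, Finsupp.coe_neg, Pi.neg_apply] at this
  simpa using le_antisymm (by linarith) (h t)

theorem isPos_neg_iff {γ : V} (hγ : γ ∈ R.roots) : R.IsPos (-γ) ↔ ¬R.IsPos γ :=
  ⟨fun h h' => h'.not_neg hγ h, (isPos_or_isPos_neg hγ).resolve_left⟩

theorem isPos_simpleRoot (s : S) : R.IsPos (R.simpleRoot s) := fun t => by
  classical
  rw [Module.Basis.repr_self, Finsupp.single_apply]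
  split_ifs <;> simp

theorem roots_proportional {γ δ : V} (hγ : γ ∈ R.roots) (hδ : δ ∈ R.roots) {a : ℝ}
    (h : γ = a • δ) : γ = δ ∨ γ = -δ := by
  obtain ⟨u, s, rfl⟩ := hγ
  obtain ⟨w, t, rfl⟩ := hδ
  rcases R.reduced u w s t a h with rfl | rfl
  · exact Or.inl (by simpa using h)
  · exact Or.inr (by simpa using h)

/-- A simple reflection makes only one positive root negative. -/
theorem eq_simpleRoot_of_isPos {γ : V} (hγ : γ ∈ R.roots) (h : R.IsPos γ) {s : S}
    (h' : ¬R.IsPos (R.rep (cs.simple s) γ)) : γ = R.simpleRoot s := by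
  classical
  have hn := (R.isPos_neg_iff (rep_mem_roots hγ _)).2 h'
  -- The reflection changes only the coordinate at `s`; any other coordinate is both nonnegative and
  -- nonpositive.
  have key : γ = R.simpleRoot.repr γ s • R.simpleRoot s := by
    apply R.simpleRoot.repr.injective
    ext t
    by_cases hst : s = t
    · subst hst; simp
    · have h1 := hn t
      rw [R.rep_simple] at h1
      simp only [map_neg, map_sub, map_smul, Module.Basis.repr_self, Finsupp.coe_neg,
        Finsupp.coe_sub, Finsupp.coe_smul, Pi.neg_apply, Pi.sub_apply, Pi.smul_apply,
        Finsupp.single_apply, if_neg hst, smul_eq_mul, mul_zero] at h1 ⊢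
      linarith [h t]
  rcases R.roots_proportional hγ (R.simpleRoot_mem s) key with h1 | h1
  · exact h1
  · rw [h1] at h
    exact absurd h ((R.isPos_simpleRoot s).not_neg (R.simpleRoot_mem s))

/-- The reflection along the root `u(α_s)`. -/
theorem rep_conj_simple (u : W) (s : S) (x : V) :
    R.rep (u * cs.simple s * u⁻¹) x = x - (2 * inner ℝ (R.rep u (R.simpleRoot s)) x /
      inner ℝ (R.simpleRoot s) (R.simpleRoot s)) • R.rep u (R.simpleRoot s) := by
  rw [rep_mul_apply, rep_mul_apply, R.rep_simple, map_sub, map_smul, rep_rep_inv,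
    inner_rep_right, inv_inv]

theorem conj_simple_eq_of_rep_eq {u w : W} {s t : S}
    (h : R.rep u (R.simpleRoot s) = R.rep w (R.simpleRoot t) ∨
      R.rep u (R.simpleRoot s) = -R.rep w (R.simpleRoot t)) :
    u * cs.simple s * u⁻¹ = w * cs.simple t * w⁻¹ := by
  apply R.rep_injective
  ext x
  have hn : inner ℝ (R.simpleRoot s) (R.simpleRoot s) =
      inner ℝ (R.simpleRoot t) (R.simpleRoot t) := by
    rw [← R.inner_rep u, ← R.inner_rep w (R.simpleRoot t)]
    rcases h with h | h <;> rw [h]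
    rw [inner_neg_neg]
  rw [rep_conj_simple, rep_conj_simple, hn]
  rcases h with h | h <;> rw [h]
  rw [inner_neg_left, smul_neg, ← neg_smul]
  congr 2
  ring

/-- Applying the letters from right to left, some letter `t` turns a positive root negative, and
that root can only be `α_t`. -/
theorem exists_deletion (ω : List S) {γ : V} (hγ : γ ∈ R.roots) (h : R.IsPos γ)
    (h' : ¬R.IsPos (R.rep (cs.wordProd ω) γ)) :
    ∃ ω₁ t ω₂, ω = ω₁ ++ t :: ω₂ ∧ R.rep (cs.wordProd ω₂) γ = R.simpleRoot t := by
  induction ω with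
  | nil => exact absurd h (by simpa [rep_one_apply] using h')
  | cons t ω ih =>
    by_cases hp : R.IsPos (R.rep (cs.wordProd ω) γ)
    · rw [cs.wordProd_cons, rep_mul_apply] at h'
      exact ⟨[], t, ω, rfl, R.eq_simpleRoot_of_isPos (rep_mem_roots hγ _) hp h'⟩
    · obtain ⟨ω₁, t', ω₂, rfl, h2⟩ := ih hp
      exact ⟨t :: ω₁, t', ω₂, rfl, h2⟩

/-- Let `t` be a letter of a reduced word of `w` at which `α_s` turns negative, and `u` the product
of the letters to its right. Then `u s u⁻¹ = t`, so multiplying by `s` on the right deletes `t` from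
the word. -/
theorem length_mul_simple_lt {w : W} {s : S} (h : ¬R.IsPos (R.rep w (R.simpleRoot s))) :
    cs.length (w * cs.simple s) < cs.length w := by
  obtain ⟨ω, hω, rfl⟩ := cs.exists_isReduced w
  obtain ⟨ω₁, t, ω₂, rfl, h2⟩ := R.exists_deletion ω (R.simpleRoot_mem s) (R.isPos_simpleRoot s) h
  have h3 := R.conj_simple_eq_of_rep_eq (u := cs.wordProd ω₂) (s := s) (w := 1) (t := t)
    (Or.inl (by rw [h2, rep_one_apply]))
  have h4 : cs.wordProd (ω₁ ++ t :: ω₂) * cs.simple s = cs.wordProd (ω₁ ++ ω₂) := by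
    rw [one_mul, inv_one, mul_one] at h3
    rw [cs.wordProd_append, cs.wordProd_append, cs.wordProd_cons, ← h3]
    simp [mul_assoc]
  rw [h4, hω.eq]
  refine (cs.length_wordProd_le _).trans_lt ?_
  simp

theorem isPos_iff_length_lt {w : W} {s : S} :
    R.IsPos (R.rep w (R.simpleRoot s)) ↔ cs.length w < cs.length (w * cs.simple s) := by
  constructor
  · intro h
    have := R.length_mul_simple_lt (w := w * cs.simple s) (s := s) (by
      rw [rep_mul_apply, rep_simple_self, map_neg]
      exact h.not_neg (R.rep_simpleRoot_mem w s))
    simpa [mul_assoc] using this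
  · intro h
    by_contra h'
    exact absurd (R.length_mul_simple_lt h') (by omega)

theorem _root_.CoxeterSystem.length_le_longest [Finite W] (cs : CoxeterSystem M W) (w : W) :
    cs.length w ≤ cs.length cs.longest :=
  Classical.choose_spec (Finite.exists_max cs.length) w

section Longest

variable [Fintype S]

theorem isPos_neg_rep {w : W} (h : ∀ s, R.IsPos (-R.rep w (R.simpleRoot s))) {γ : V}
    (hγ : R.IsPos γ) : R.IsPos (-R.rep w γ) := by
  intro t
  rw [← R.simpleRoot.sum_repr γ]
  simp only [map_sum, map_smul, ← Finset.sum_neg_distrib, ← smul_neg]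
  rw [Finsupp.finsetSum_apply]
  exact Finset.sum_nonneg fun s _ => by
    rw [Finsupp.smul_apply, smul_eq_mul]
    exact mul_nonneg (hγ s) (h s t)

variable [Finite W]

/-- No right multiplication can lengthen an element of maximal length. -/
theorem isPos_neg_longest_inv {γ : V} (hγ : R.IsPos γ) :
    R.IsPos (-R.rep cs.longest⁻¹ γ) := by
  refine R.isPos_neg_rep (fun s => ?_) hγ
  rw [R.isPos_neg_iff (R.rep_simpleRoot_mem _ _), isPos_iff_length_lt, not_lt, cs.length_inv]
  exact cs.length_le_longest _

end Longest

end CoxeterRootSystem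

/-! ### Subwords and prefix products of facets. -/

theorem subwordAt_insert {S : Type*} (Q : List S) (A : Finset (Fin Q.length)) (k : Fin Q.length)
    (h : ∀ j ∈ A, j < k) : subwordAt Q (insert k A) = subwordAt Q A ++ [Q.get k] := by
  have hk : k ∉ A := fun hk => lt_irrefl k (h k hk)
  have : (insert k A).sort (· ≤ ·) = A.sort (· ≤ ·) ++ [k] := by
    refine List.Perm.eq_of_pairwise' (Finset.pairwise_sort _ _) ?_ ?_
    · rw [List.pairwise_append]
      refine ⟨Finset.pairwise_sort _ _, List.pairwise_singleton _ _, fun a ha b hb => ?_⟩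
      rw [List.mem_singleton.1 hb]
      exact (h a ((Finset.mem_sort _).1 ha)).le
    · rw [List.perm_ext_iff_of_nodup (Finset.sort_nodup _ _)]
      · intro a
        simp [or_comm]
      · rw [List.nodup_append]
        refine ⟨Finset.sort_nodup _ _, List.nodup_singleton _, ?_⟩
        simp only [Finset.mem_sort, List.mem_singleton, ne_eq, forall_eq]
        exact fun a ha h' => hk (h' ▸ ha)
  simp [subwordAt, this]

theorem length_subwordAt {S : Type*} (Q : List S) (A : Finset (Fin Q.length)) :
    (subwordAt Q A).length = A.card := by
  simp [subwordAt]

namespace CoxeterSystem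

variable {S W : Type*} [Group W] {M : CoxeterMatrix S} (cs : CoxeterSystem M W)

/-- The product of the letters of `Q` at the positions before `k` that are not in `I`. -/
noncomputable def prefixProd (Q : List S) (I : Finset (Fin Q.length)) (k : ℕ) : W :=
  cs.wordProd (subwordAt Q (Finset.univ.filter (fun j => j.val < k) \ I))

variable {Q : List S} (I : Finset (Fin Q.length))

theorem filter_lt_succ (k : Fin Q.length) :
    Finset.univ.filter (fun j : Fin Q.length => j.val < k.val + 1) =
      insert k (Finset.univ.filter fun j : Fin Q.length => j.val < k.val) := by
  ext j
  simp [Fin.ext_iff]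
  omega

theorem prefixProd_zero : cs.prefixProd Q I 0 = 1 := by
  simp [prefixProd, subwordAt]

theorem prefixProd_length : cs.prefixProd Q I Q.length = cs.wordProd (subwordAt Q Iᶜ) := by
  simp [prefixProd, Finset.compl_eq_univ_sdiff]

variable {I}

theorem prefixProd_succ_of_mem {k : Fin Q.length} (h : k ∈ I) :
    cs.prefixProd Q I (k + 1) = cs.prefixProd Q I k := by
  rw [prefixProd, prefixProd, filter_lt_succ, Finset.insert_sdiff_of_mem _ h]

theorem prefixProd_succ_of_notMem {k : Fin Q.length} (h : k ∉ I) :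
    cs.prefixProd Q I (k + 1) = cs.prefixProd Q I k * cs.simple (Q.get k) := by
  rw [prefixProd, prefixProd, filter_lt_succ, Finset.insert_sdiff_of_notMem _ h,
    subwordAt_insert, cs.wordProd_append, cs.wordProd_singleton]
  intro j hj
  simp only [Finset.mem_sdiff, Finset.mem_filter, Finset.mem_univ, true_and] at hj
  exact hj.1

theorem length_prefixProd_le (k : ℕ) : cs.length (cs.prefixProd Q I k) ≤
    (Finset.univ.filter (fun j : Fin Q.length => j.val < k) \ I).card :=
  (cs.length_wordProd_le _).trans (length_subwordAt _ _).le

theorem card_filter_lt_succ {k : Fin Q.length} (h : k ∉ I) :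
    (Finset.univ.filter (fun j : Fin Q.length => j.val < k + 1) \ I).card =
      (Finset.univ.filter (fun j : Fin Q.length => j.val < k) \ I).card + 1 := by
  rw [filter_lt_succ, Finset.insert_sdiff_of_notMem _ h, Finset.card_insert_of_notMem]
  simp

/-- Each letter raises the length by at most one. For a facet the final length equals the number of
letters, so no letter may fail to raise it. -/
theorem length_prefixProd_add_le {k l : ℕ} (hkl : k ≤ l) (hl : l ≤ Q.length) :
    cs.length (cs.prefixProd Q I l) +
        (Finset.univ.filter (fun j : Fin Q.length => j.val < k) \ I).card ≤
      cs.length (cs.prefixProd Q I k) +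
        (Finset.univ.filter (fun j : Fin Q.length => j.val < l) \ I).card := by
  induction l, hkl using Nat.le_induction with
  | base => exact le_rfl
  | succ l hkl ih =>
    have ih := ih (by omega)
    by_cases h : (⟨l, hl⟩ : Fin Q.length) ∈ I
    · have h1 := cs.prefixProd_succ_of_mem h
      have h2 := filter_lt_succ (⟨l, hl⟩ : Fin Q.length)
      simp only at h1 h2
      rw [h1, h2, Finset.insert_sdiff_of_mem _ h]
      exact ih
    · have h1 := cs.prefixProd_succ_of_notMem h
      have h2 := card_filter_lt_succ h
      have h3 := cs.length_mul_le (cs.prefixProd Q I l) (cs.simple (Q.get ⟨l, hl⟩))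
      rw [cs.length_simple] at h3
      simp only at h1 h2
      rw [h1, h2]
      omega

variable [Finite W]

variable {cs} in
theorem IsFacet.prefixProd_length (h : cs.IsFacet Q I) :
    cs.prefixProd Q I Q.length = cs.longest := by
  rw [cs.prefixProd_length, h.2]

variable {cs} in
theorem IsFacet.card_compl (h : cs.IsFacet Q I) : Iᶜ.card = cs.length cs.longest := by
  rw [← length_subwordAt, ← h.2, h.1.eq]

theorem isFacet_of_prefixProd (h : cs.prefixProd Q I Q.length = cs.longest)
    (h' : Iᶜ.card = cs.length cs.longest) : cs.IsFacet Q I := by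
  rw [cs.prefixProd_length] at h
  exact ⟨by rw [IsReduced, h, length_subwordAt, h'], h⟩

variable {cs} in
theorem IsFacet.length_prefixProd_lt (h : cs.IsFacet Q I) {k : Fin Q.length} (hk : k ∉ I) :
    cs.length (cs.prefixProd Q I k) <
      cs.length (cs.prefixProd Q I k * cs.simple (Q.get k)) := by
  have h1 := cs.length_prefixProd_add_le (I := I) (k := k + 1) (l := Q.length) k.2 le_rfl
  have h2 := cs.length_prefixProd_le (I := I) k
  have h3 : Finset.univ.filter (fun j : Fin Q.length => j.val < Q.length) \ I = Iᶜ := by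
    simp [Finset.compl_eq_univ_sdiff]
  rw [h.prefixProd_length, card_filter_lt_succ hk, h3, h.card_compl,
    cs.prefixProd_succ_of_notMem hk] at h1
  omega

end CoxeterSystem

/-! ### Roots crossed by the reduced word of a facet. -/

namespace CoxeterRootSystem

variable {S W : Type*} [Group W] {M : CoxeterMatrix S} {cs : CoxeterSystem M W}
  {V : Type*} [NormedAddCommGroup V] [InnerProductSpace ℝ V] (R : CoxeterRootSystem cs V)
  {Q : List S} {I J : Finset (Fin Q.length)}

theorem rootFunction_eq (I : Finset (Fin Q.length)) (k : Fin Q.length) : R.rootFunction Q I k =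
    R.rep (cs.prefixProd Q I k) (R.simpleRoot (Q.get k)) := rfl

theorem weightFunction_eq [Fintype S] (I : Finset (Fin Q.length)) (k : Fin Q.length) :
    R.weightFunction Q I k = R.rep (cs.prefixProd Q I k) (R.weight (Q.get k)) := rfl

theorem rootFunction_mem (I : Finset (Fin Q.length)) (k : Fin Q.length) :
    R.rootFunction Q I k ∈ R.roots := R.rep_simpleRoot_mem _ _

theorem rep_prefixProd_inv_rootFunction (I : Finset (Fin Q.length)) (k : Fin Q.length) :
    R.rep (cs.prefixProd Q I k)⁻¹ (R.rootFunction Q I k) = R.simpleRoot (Q.get k) := by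
  rw [rootFunction_eq, rep_inv_rep]

variable [Finite W]

theorem isPos_rootFunction (h : cs.IsFacet Q I) {k : Fin Q.length} (hk : k ∉ I) :
    R.IsPos (R.rootFunction Q I k) := by
  rw [rootFunction_eq, isPos_iff_length_lt]
  exact h.length_prefixProd_lt hk

/-- Each positive root is crossed exactly once by the reduced word of a facet. -/
theorem exists_crossing [Fintype S] (h : cs.IsFacet Q I) {β : V} (hβ : β ∈ R.roots)
    (hp : R.IsPos β) : ∃ j ∉ I, R.rootFunction Q I j = β ∧
      ∀ k ≤ Q.length, R.IsPos (R.rep (cs.prefixProd Q I k)⁻¹ β) ↔ k ≤ j := by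
  classical
  have hend : ¬R.IsPos (R.rep (cs.prefixProd Q I Q.length)⁻¹ β) := by
    rw [h.prefixProd_length, ← R.isPos_neg_iff (rep_mem_roots hβ _)]
    exact R.isPos_neg_longest_inv hp
  have hex : ∃ k, ¬R.IsPos (R.rep (cs.prefixProd Q I k)⁻¹ β) := ⟨_, hend⟩
  obtain ⟨k, hk⟩ : ∃ k, Nat.find hex = k := ⟨_, rfl⟩
  have hlt : ∀ l < k, R.IsPos (R.rep (cs.prefixProd Q I l)⁻¹ β) := fun l hl =>
    not_not.1 (Nat.find_min hex (hk ▸ hl))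
  have hnot : ¬R.IsPos (R.rep (cs.prefixProd Q I k)⁻¹ β) := hk ▸ Nat.find_spec hex
  have hle : k ≤ Q.length := hk ▸ Nat.find_min' hex hend
  clear hk
  cases k with
  | zero => rw [cs.prefixProd_zero, inv_one, rep_one_apply] at hnot; exact absurd hp hnot
  | succ j =>
    obtain ⟨j, rfl⟩ : ∃ j' : Fin Q.length, j = j' := ⟨⟨j, hle⟩, rfl⟩
    have hj : j ∉ I := fun hj => hnot (by
      rw [cs.prefixProd_succ_of_mem hj]; exact hlt j (Nat.lt_succ_self _))
    have hstep : ∀ l : Fin Q.length, l ∉ I → R.rep (cs.prefixProd Q I (l + 1))⁻¹ β =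
        R.rep (cs.simple (Q.get l)) (R.rep (cs.prefixProd Q I l)⁻¹ β) := fun l hl => by
      rw [cs.prefixProd_succ_of_notMem hl, mul_inv_rev, cs.inv_simple, rep_mul_apply]
    have hafter : ∀ l : ℕ, (j : ℕ) + 1 ≤ l → l ≤ Q.length →
        ¬R.IsPos (R.rep (cs.prefixProd Q I l)⁻¹ β) := by
      intro l hl
      induction l, hl using Nat.le_induction with
      | base => exact fun _ => hnot
      | succ l hl ih =>
        intro hl' hpos
        obtain ⟨l, rfl⟩ : ∃ j' : Fin Q.length, l = j' := ⟨⟨l, hl'⟩, rfl⟩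
        have ih := ih (by omega)
        by_cases hlI : l ∈ I
        · rw [cs.prefixProd_succ_of_mem hlI] at hpos
          exact ih hpos
        · rw [hstep l hlI] at hpos
          have hm := rep_mem_roots hβ (cs.prefixProd Q I l)⁻¹
          -- If the root turned positive again at `l`, the root function at `l` would be `-β`; but
          -- outside a facet the root function is positive.
          have := R.eq_simpleRoot_of_isPos (s := Q.get l) (neg_mem_roots hm)
            ((R.isPos_neg_iff hm).2 ih) (by
              rw [map_neg]; exact hpos.not_neg (rep_mem_roots hm _))
          have h2 := R.isPos_rootFunction h hlI
          rw [rootFunction_eq, ← this, map_neg, rep_rep_inv] at h2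
          exact hp.not_neg hβ h2
    refine ⟨j, hj, ?_, fun l hl => ⟨fun hlp => ?_, fun hlj => hlt l (by omega)⟩⟩
    · rw [hstep j hj] at hnot
      have := R.eq_simpleRoot_of_isPos (rep_mem_roots hβ _) (hlt j (Nat.lt_succ_self _)) hnot
      rw [rootFunction_eq, ← this, rep_rep_inv]
    · by_contra hlj
      exact hafter l (by omega) hl hlp

/-- A position outside `I` whose root is `β` has `β` positive before it and negative right after, so
it is the unique crossing of `β`. -/
theorem rootFunction_injOn [Fintype S] (h : cs.IsFacet Q I) {j j' : Fin Q.length} (hj : j ∉ I)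
    (hj' : j' ∉ I) (hr : R.rootFunction Q I j = R.rootFunction Q I j') : j = j' := by
  obtain ⟨k, -, -, hk⟩ := R.exists_crossing h (R.rootFunction_mem I j) (R.isPos_rootFunction h hj)
  have key : ∀ l : Fin Q.length, l ∉ I → R.rootFunction Q I j = R.rootFunction Q I l →
      (l : ℕ) = k := by
    intro l hl hlr
    have h1 := (hk l l.2.le).1 (by
      rw [hlr, rep_prefixProd_inv_rootFunction]; exact R.isPos_simpleRoot _)
    have h2 := mt (hk (l + 1) l.2).2 (by
      rw [hlr, cs.prefixProd_succ_of_notMem hl, mul_inv_rev, cs.inv_simple, rep_mul_apply,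
        rep_prefixProd_inv_rootFunction, rep_simple_self]
      exact (R.isPos_simpleRoot _).not_neg (R.simpleRoot_mem _))
    omega
  exact Fin.ext ((key j hj rfl).trans (key j' hj' hr).symm)

end CoxeterRootSystem

/-! ### Flips of facets. -/

namespace CoxeterSystem

variable {S W : Type*} [Group W] {M : CoxeterMatrix S} (cs : CoxeterSystem M W)
variable {Q : List S} {I : Finset (Fin Q.length)}

open Classical in
/-- Exchanging two positions whose roots agree up to sign multiplies the prefix products between
them by the corresponding reflection. -/
theorem prefixProd_exchange {i j : Fin Q.length} (hi : i ∈ I) (hj : j ∉ I) {t : W}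
    (hti : t * cs.prefixProd Q I i = cs.prefixProd Q I i * cs.simple (Q.get i))
    (htj : t * cs.prefixProd Q I j = cs.prefixProd Q I j * cs.simple (Q.get j))
    (ht : t * t = 1) {k : ℕ} (hk : k ≤ Q.length) :
    cs.prefixProd Q (insert j (I.erase i)) k =
      if (i < k ∧ k ≤ j) ∨ (j < k ∧ k ≤ i) then t * cs.prefixProd Q I k
      else cs.prefixProd Q I k := by
  have hij : i ≠ j := fun h => hj (h ▸ hi)
  have hij' : (i : ℕ) ≠ j := fun h => hij (Fin.ext h)
  induction k with
  | zero => simp [prefixProd_zero]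
  | succ k ih =>
    obtain ⟨k, rfl⟩ : ∃ k' : Fin Q.length, k = k' := ⟨⟨k, hk⟩, rfl⟩
    have ih := ih (by omega)
    have htt : ∀ x : W, t * (t * x) = x := fun x => by rw [← mul_assoc, ht, one_mul]
    -- At `i` and at `j` a letter is added or dropped; moved to the left of the prefix it becomes
    -- `t`. Other letters just multiply both prefixes on the right.
    by_cases hki : k = i
    · subst hki
      rw [cs.prefixProd_succ_of_notMem (I := insert j (I.erase k)) (by simp [hij]), ih,
        cs.prefixProd_succ_of_mem hi]
      by_cases hlt : (k : ℕ) < j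
      · rw [if_neg (by omega), if_pos (by omega), hti]
      · rw [if_pos (by omega), if_neg (by omega), hti, cs.simple_mul_simple_cancel_right]
    · by_cases hkj : k = j
      · subst hkj
        rw [cs.prefixProd_succ_of_mem (I := insert k (I.erase i)) (by simp), ih,
          cs.prefixProd_succ_of_notMem hj, ← htj, htt]
        by_cases hlt : (k : ℕ) < i
        · rw [if_neg (by omega), if_pos (by omega)]
        · rw [if_pos (by omega), if_neg (by omega)]
      · have hki' : (k : ℕ) ≠ i := fun h => hki (Fin.ext h)
        have hkj' : (k : ℕ) ≠ j := fun h => hkj (Fin.ext h)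
        have hiff : ((i : ℕ) < k + 1 ∧ (k : ℕ) + 1 ≤ j) ∨ ((j : ℕ) < k + 1 ∧ (k : ℕ) + 1 ≤ i) ↔
            ((i : ℕ) < k ∧ (k : ℕ) ≤ j) ∨ ((j : ℕ) < k ∧ (k : ℕ) ≤ i) := by omega
        by_cases hkI : k ∈ I
        · rw [cs.prefixProd_succ_of_mem (I := insert j (I.erase i)) (by simp [hkI, hki]), ih,
            cs.prefixProd_succ_of_mem hkI]
          simp only [hiff]
        · rw [cs.prefixProd_succ_of_notMem (I := insert j (I.erase i)) (by simp [hkI, hkj]), ih,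
            cs.prefixProd_succ_of_notMem hkI]
          simp only [hiff, ite_mul, mul_assoc]

end CoxeterSystem

namespace CoxeterRootSystem

variable {S W : Type*} [Group W] {M : CoxeterMatrix S} {cs : CoxeterSystem M W}
  {V : Type*} [NormedAddCommGroup V] [InnerProductSpace ℝ V] (R : CoxeterRootSystem cs V)
  {Q : List S} {I J : Finset (Fin Q.length)} [Fintype S]

theorem inner_weight_eq (s : S) (x : V) : inner ℝ (R.weight s) x =
    inner ℝ (R.simpleRoot s) (R.simpleRoot s) / 2 * R.simpleRoot.repr x s := by
  classical
  conv_lhs => rw [← R.simpleRoot.sum_repr x]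
  simp only [inner_sum, real_inner_smul_right, inner_weight, mul_ite, mul_zero,
    Finset.sum_ite_eq, Finset.mem_univ, if_true]
  ring

/-- Reduces the sign of the change of a weight under a reflection to the sign of one simple root
coordinate. -/
theorem inner_rep_weight (w : W) (s : S) (x : V) : inner ℝ x (R.rep w (R.weight s)) =
    inner ℝ (R.simpleRoot s) (R.simpleRoot s) / 2 * R.simpleRoot.repr (R.rep w⁻¹ x) s := by
  rw [inner_rep_right, real_inner_comm, inner_weight_eq]

variable [Finite W]

/-- Each position of a facet can be flipped; the flip changes the root and weight functions only by
multiples of the root at the flipped position. -/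
theorem exists_flip (h : cs.IsFacet Q I) {i : Fin Q.length} (hi : i ∈ I) :
    ∃ j ∉ I, ∃ J : Finset (Fin Q.length), cs.IsFacet Q J ∧ (∀ k, k ∈ J ↔ k = j ∨ k ≠ i ∧ k ∈ I) ∧
      R.rootFunction Q J j = -R.rootFunction Q I i ∧
      (R.rootFunction Q J i = R.rootFunction Q I i ∨
        R.rootFunction Q J i = -R.rootFunction Q I i) ∧
      (∀ k, R.rootFunction Q J k = R.rootFunction Q I k ∨ R.rootFunction Q J k =
        R.rep (cs.prefixProd Q I i * cs.simple (Q.get i) * (cs.prefixProd Q I i)⁻¹)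
          (R.rootFunction Q I k)) ∧
      (∀ k, ∃ a : ℝ, 0 ≤ a ∧
        R.weightFunction Q J k = R.weightFunction Q I k - a • R.rootFunction Q I i) ∧
      ∃ k, ∃ a : ℝ, 0 < a ∧
        R.weightFunction Q J k = R.weightFunction Q I k - a • R.rootFunction Q I i := by
  classical
  set β := R.rootFunction Q I i with hβdef
  have hβ : β ∈ R.roots := R.rootFunction_mem I i
  -- The partner of `i` is the crossing of `β` or of `-β`, whichever is positive. It lies to the
  -- right of `i` in the first case and to the left in the second.
  obtain ⟨j, hj, hjr, hjp⟩ : ∃ j ∉ I, (R.rootFunction Q I j = β ∨ R.rootFunction Q I j = -β) ∧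
      ((∀ k ≤ Q.length, R.IsPos (R.rep (cs.prefixProd Q I k)⁻¹ β) ↔ k ≤ (j : ℕ)) ∧
        R.rootFunction Q I j = β ∨
      (∀ k ≤ Q.length, R.IsPos (-R.rep (cs.prefixProd Q I k)⁻¹ β) ↔ k ≤ (j : ℕ)) ∧
        R.rootFunction Q I j = -β) := by
    rcases isPos_or_isPos_neg hβ with hp | hp
    · obtain ⟨j, hj, h1, h2⟩ := R.exists_crossing h hβ hp
      exact ⟨j, hj, Or.inl h1, Or.inl ⟨h2, h1⟩⟩
    · obtain ⟨j, hj, h1, h2⟩ := R.exists_crossing h (neg_mem_roots hβ) hp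
      refine ⟨j, hj, Or.inr h1, Or.inr ⟨fun k hk => ?_, h1⟩⟩
      rw [← h2 k hk, map_neg]
  have hij : i ≠ j := fun h => hj (h ▸ hi)
  have hij' : (i : ℕ) ≠ j := fun h => hij (Fin.ext h)
  set t := cs.prefixProd Q I i * cs.simple (Q.get i) * (cs.prefixProd Q I i)⁻¹ with htdef
  have htj : t = cs.prefixProd Q I j * cs.simple (Q.get j) * (cs.prefixProd Q I j)⁻¹ := by
    refine (R.conj_simple_eq_of_rep_eq ?_).symm
    rw [← rootFunction_eq, ← rootFunction_eq]
    exact hjr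
  have htt : t * t = 1 := by simp [htdef, mul_assoc]
  have hpp := fun {k} (hk : k ≤ Q.length) => cs.prefixProd_exchange hi hj (t := t)
    (by rw [htdef]; group) (by rw [htj]; group) htt hk
  have htβ : R.rep t β = -β := by
    rw [htdef, hβdef, rootFunction_eq, rep_mul_apply, rep_inv_rep, rep_mul_apply, rep_simple_self,
      map_neg]
  -- Between the two positions the weight is reflected along `β`. Up to a positive factor the
  -- coefficient is a coordinate of `β` pulled back by the prefix, and that pullback is positive
  -- there.
  have hwt : ∀ k : Fin Q.length, ((i : ℕ) < k ∧ (k : ℕ) ≤ j) ∨ ((j : ℕ) < k ∧ (k : ℕ) ≤ i) →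
      R.weightFunction Q (insert j (I.erase i)) k = R.weightFunction Q I k -
        (2 * (inner ℝ (R.simpleRoot (Q.get k)) (R.simpleRoot (Q.get k)) / 2 *
          R.simpleRoot.repr (R.rep (cs.prefixProd Q I k)⁻¹ β) (Q.get k)) /
          inner ℝ (R.simpleRoot (Q.get i)) (R.simpleRoot (Q.get i))) • β := by
    intro k hk
    rw [weightFunction_eq, hpp k.2.le, if_pos hk, rep_mul_apply, rep_conj_simple,
      ← rootFunction_eq, ← hβdef, inner_rep_weight, ← weightFunction_eq]
  have hsq : ∀ s, 0 < inner ℝ (R.simpleRoot s) (R.simpleRoot s) := R.inner_simpleRoot_self_pos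
  refine ⟨j, hj, insert j (I.erase i), ?_, ?_, ?_, ?_, ?_, ?_, ?_⟩
  · apply cs.isFacet_of_prefixProd
    · rw [hpp le_rfl, if_neg (by omega), h.prefixProd_length]
    · rw [← h.card_compl, Finset.card_compl, Finset.card_compl, Finset.card_insert_of_notMem
        (by simp [hj]), Finset.card_erase_add_one hi]
  · intro k; simp
  · rw [rootFunction_eq, hpp j.2.le]
    rcases hjp with ⟨hp, hr⟩ | ⟨hp, hr⟩
    · have := (hp i i.2.le).1 (by
        rw [hβdef, rep_prefixProd_inv_rootFunction]; exact R.isPos_simpleRoot _)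
      rw [if_pos (by omega), rep_mul_apply, ← rootFunction_eq, hr, htβ]
    · have := mt (hp i i.2.le).2 (by
        rw [hβdef, rep_prefixProd_inv_rootFunction]
        exact (R.isPos_simpleRoot _).not_neg (R.simpleRoot_mem _))
      rw [if_neg (by omega), ← rootFunction_eq, hr]
  · rw [rootFunction_eq, hpp i.2.le]
    split_ifs
    · rw [rep_mul_apply, ← rootFunction_eq, ← hβdef, htβ]
      exact Or.inr rfl
    · exact Or.inl rfl
  · intro k
    rw [rootFunction_eq, hpp k.2.le]
    split_ifs
    · rw [rep_mul_apply]
      exact Or.inr rfl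
    · exact Or.inl rfl
  · intro k
    by_cases hk : ((i : ℕ) < k ∧ (k : ℕ) ≤ j) ∨ ((j : ℕ) < k ∧ (k : ℕ) ≤ i)
    · refine ⟨_, ?_, hwt k hk⟩
      have hp : R.IsPos (R.rep (cs.prefixProd Q I k)⁻¹ β) := by
        have hm := rep_mem_roots hβ (cs.prefixProd Q I k)⁻¹
        rcases hjp with ⟨hp, -⟩ | ⟨hp, -⟩
        · have := (hp i i.2.le).1 (by
            rw [hβdef, rep_prefixProd_inv_rootFunction]; exact R.isPos_simpleRoot _)
          exact (hp k k.2.le).2 (by omega)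
        · have := mt (hp i i.2.le).2 (by
            rw [hβdef, rep_prefixProd_inv_rootFunction]
            exact (R.isPos_simpleRoot _).not_neg (R.simpleRoot_mem _))
          by_contra hneg
          have := (hp k k.2.le).1 ((R.isPos_neg_iff hm).2 hneg)
          omega
      have h1 := hp (Q.get k)
      have h2 := hsq (Q.get k)
      have h3 := hsq (Q.get i)
      positivity
    · refine ⟨0, le_rfl, ?_⟩
      rw [weightFunction_eq, hpp k.2.le, if_neg hk, zero_smul, sub_zero, ← weightFunction_eq]
  -- At the right end of the interval the pullback of `β` is the simple root of that very letter, so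
  -- the coordinate is `1`.
  · by_cases hlt : (i : ℕ) < j
    · refine ⟨j, _, ?_, hwt j (Or.inl ⟨hlt, le_rfl⟩)⟩
      have hr : R.rootFunction Q I j = β := by
        rcases hjp with ⟨hp, hr⟩ | ⟨hp, -⟩
        · exact hr
        · have := mt (hp i i.2.le).2 (by
            rw [hβdef, rep_prefixProd_inv_rootFunction]
            exact (R.isPos_simpleRoot _).not_neg (R.simpleRoot_mem _))
          omega
      rw [← hr, rep_prefixProd_inv_rootFunction, Module.Basis.repr_self, Finsupp.single_eq_same]
      have h2 := hsq (Q.get j)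
      have h3 := hsq (Q.get i)
      positivity
    · refine ⟨i, _, ?_, hwt i (Or.inr ⟨by omega, le_rfl⟩)⟩
      rw [hβdef, rep_prefixProd_inv_rootFunction, Module.Basis.repr_self, Finsupp.single_eq_same]
      have h3 := hsq (Q.get i)
      positivity

end CoxeterRootSystem

/-! ### Root configurations, chambers and the facet of a chamber. -/

namespace CoxeterRootSystem

variable {S W : Type*} [Group W] {M : CoxeterMatrix S} {cs : CoxeterSystem M W}
  {V : Type*} [NormedAddCommGroup V] [InnerProductSpace ℝ V] (R : CoxeterRootSystem cs V)
  {Q : List S} {I J : Finset (Fin Q.length)}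

/-- The span of the root configuration of `I`. -/
noncomputable def rootSpan (Q : List S) (I : Finset (Fin Q.length)) : Submodule ℝ V :=
  Submodule.span ℝ {x | ∃ i ∈ I, x = R.rootFunction Q I i}

theorem rootFunction_mem_rootSpan {i : Fin Q.length} (hi : i ∈ I) :
    R.rootFunction Q I i ∈ R.rootSpan Q I :=
  Submodule.subset_span ⟨i, hi, rfl⟩

section

variable [Finite W]

/-- The facet `I` has its root configuration in `w(Φ⁺)`. -/
def IsGood (Q : List S) (w : W) (I : Finset (Fin Q.length)) : Prop :=
  cs.IsFacet Q I ∧ ∀ i ∈ I, R.IsPos (R.rep w⁻¹ (R.rootFunction Q I i))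

/-- The prefix product after `k` decides whether `k ∈ I`: it sends the simple root of the letter to
`r(I, k)` if `k ∈ I` and to `-r(I, k)` if not, and `r(I, k)` is positive in both cases. Starting
from `w₀` at the right end, this reconstructs `I` backwards. -/
theorem isGood_one_unique (hI : R.IsGood Q 1 I) (hJ : R.IsGood Q 1 J) : I = J := by
  have hmem : ∀ {I : Finset (Fin Q.length)}, R.IsGood Q 1 I → ∀ k : Fin Q.length,
      k ∈ I ↔ R.IsPos (R.rep (cs.prefixProd Q I (k + 1)) (R.simpleRoot (Q.get k))) := by
    intro I hI k
    constructor
    · intro hk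
      have := hI.2 k hk
      rwa [inv_one, rep_one_apply, rootFunction_eq, ← cs.prefixProd_succ_of_mem hk] at this
    · intro hp
      by_contra hk
      rw [cs.prefixProd_succ_of_notMem hk, rep_mul_apply, rep_simple_self, map_neg,
        ← rootFunction_eq] at hp
      exact (R.isPos_rootFunction hI.1 hk).not_neg (R.rootFunction_mem I k) hp
  have key : ∀ d k, k + d = Q.length → cs.prefixProd Q I k = cs.prefixProd Q J k := by
    intro d
    induction d with
    | zero => rintro k rfl; rw [hI.1.prefixProd_length, hJ.1.prefixProd_length]
    | succ d ih =>
      intro k hk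
      obtain ⟨k, rfl⟩ : ∃ k' : Fin Q.length, k = k' := ⟨⟨k, by omega⟩, rfl⟩
      have h1 := ih (k + 1) (by omega)
      have hiff : k ∈ I ↔ k ∈ J := by rw [hmem hI, hmem hJ, h1]
      by_cases hkI : k ∈ I
      · rwa [cs.prefixProd_succ_of_mem hkI, cs.prefixProd_succ_of_mem (hiff.1 hkI)] at h1
      · rw [cs.prefixProd_succ_of_notMem hkI,
          cs.prefixProd_succ_of_notMem (mt hiff.2 hkI)] at h1
        exact mul_right_cancel h1
  ext k
  rw [hmem hI, hmem hJ, key (Q.length - (k + 1)) (k + 1) (by omega)]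

end

variable [Fintype S]

/-- The sum `ρ` of the fundamental weights. -/
noncomputable def weightSum : V := ∑ s, R.weight s

theorem inner_weightSum (x : V) : inner ℝ R.weightSum x =
    ∑ s, inner ℝ (R.simpleRoot s) (R.simpleRoot s) / 2 * R.simpleRoot.repr x s := by
  rw [weightSum, sum_inner]
  exact Finset.sum_congr rfl fun s _ => R.inner_weight_eq s x

theorem inner_weightSum_pos {γ : V} (hγ : γ ∈ R.roots) (hp : R.IsPos γ) :
    0 < inner ℝ R.weightSum γ := by
  rw [inner_weightSum]
  have hnn : ∀ s, 0 ≤ inner ℝ (R.simpleRoot s) (R.simpleRoot s) / 2 * R.simpleRoot.repr γ s :=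
    fun s => mul_nonneg (by have := R.inner_simpleRoot_self_pos s; positivity) (hp s)
  refine lt_of_le_of_ne (Finset.sum_nonneg fun s _ => hnn s) fun h0 => ?_
  rw [eq_comm, Finset.sum_eq_zero_iff_of_nonneg fun s _ => hnn s] at h0
  refine ne_zero_of_mem_roots hγ (R.simpleRoot.repr.injective ?_)
  ext s
  have h1 := R.inner_simpleRoot_self_pos s
  simpa [h1.ne', R.simpleRoot.ne_zero s] using h0 s (Finset.mem_univ s)

theorem rep_simple_weightSum (s : S) :
    R.rep (cs.simple s) R.weightSum = R.weightSum - R.simpleRoot s := by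
  classical
  have h := (R.inner_simpleRoot_self_pos s).ne'
  rw [R.rep_simple, real_inner_comm, inner_weightSum]
  simp only [Module.Basis.repr_self, Finsupp.single_apply, mul_ite, mul_one, mul_zero,
    Finset.sum_ite_eq, Finset.mem_univ, if_true]
  rw [mul_div_cancel₀ _ two_ne_zero, div_self h, one_smul]

/-- The vector `v` lies in the closed chamber of `w`. -/
def InChamber (w : W) (v : V) : Prop := ∀ γ, R.IsPos γ → 0 ≤ inner ℝ v (R.rep w γ)

/-- Choose `w` maximizing `⟨v, w(ρ)⟩`. Since `s(ρ) = ρ - α_s`, comparison with `ws` gives `⟨v,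
w(α_s)⟩ ≥ 0`. -/
theorem exists_inChamber [Finite W] (v : V) : ∃ w, R.InChamber w v := by
  obtain ⟨w, hw⟩ := Finite.exists_max fun w => inner ℝ v (R.rep w R.weightSum)
  refine ⟨w, fun γ hγ => ?_⟩
  rw [← R.simpleRoot.sum_repr γ, map_sum, inner_sum]
  refine Finset.sum_nonneg fun s _ => ?_
  rw [map_smul, real_inner_smul_right]
  refine mul_nonneg (hγ s) ?_
  have h := hw (w * cs.simple s)
  rw [rep_mul_apply, rep_simple_weightSum, map_sub, inner_sub_right] at h
  linarith

variable [Finite W]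

/-- Improving flips lead from each facet to one whose root configuration lies in `w(Φ⁺)`. -/
theorem exists_isGood (w : W) (hJ : cs.IsFacet Q J) : ∃ I, R.IsGood Q w I ∧
    R.rootSpan Q I = R.rootSpan Q J ∧ ∀ v, R.InChamber w v → ∀ k,
      inner ℝ v (R.weightFunction Q J k) ≤ inner ℝ v (R.weightFunction Q I k) := by
  -- The functional `w(ρ)` is strictly positive on `w(Φ⁺)`, so its sum over all positions strictly
  -- increases under an improving flip. A maximizer among the facets that satisfy the remaining
  -- claims admits no such flip.
  obtain ⟨⟨I, hI, hspan, hle⟩, hmax⟩ := @Finite.exists_max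
    {I // cs.IsFacet Q I ∧ R.rootSpan Q I = R.rootSpan Q J ∧ ∀ v, R.InChamber w v → ∀ k,
      inner ℝ v (R.weightFunction Q J k) ≤ inner ℝ v (R.weightFunction Q I k)} _ _
    ⟨⟨J, hJ, rfl, fun _ _ _ => le_rfl⟩⟩ _
    fun I => ∑ k, inner ℝ (R.rep w R.weightSum) (R.weightFunction Q I.1 k)
  refine ⟨I, ⟨hI, fun i hi => ?_⟩, hspan, hle⟩
  by_contra hneg
  have hroot := R.rootFunction_mem I i
  rw [← R.isPos_neg_iff (rep_mem_roots hroot _), ← map_neg] at hneg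
  obtain ⟨j, hj, K, hK, hKmem, hKj, -, hKr, hKw, k₀, a₀, ha₀, hk₀⟩ := R.exists_flip hI hi
  have hKr' : ∀ k, ∃ a : ℝ, R.rootFunction Q K k =
      R.rootFunction Q I k - a • R.rootFunction Q I i := by
    intro k
    rcases hKr k with h | h
    · exact ⟨0, by rw [h, zero_smul, sub_zero]⟩
    · rw [rep_conj_simple, ← rootFunction_eq] at h
      exact ⟨_, h⟩
  have hiK : R.rootFunction Q I i ∈ R.rootSpan Q K := by
    rw [← neg_neg (R.rootFunction Q I i), ← hKj]
    exact neg_mem (R.rootFunction_mem_rootSpan ((hKmem j).2 (Or.inl rfl)))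
  have hspanK : R.rootSpan Q K = R.rootSpan Q I := by
    apply le_antisymm <;> refine Submodule.span_le.2 ?_ <;> rintro _ ⟨k, hk, rfl⟩
    · rcases (hKmem k).1 hk with rfl | ⟨-, hkI⟩
      · rw [hKj]
        exact neg_mem (R.rootFunction_mem_rootSpan hi)
      · obtain ⟨a, ha⟩ := hKr' k
        rw [ha]
        exact sub_mem (R.rootFunction_mem_rootSpan hkI)
          (Submodule.smul_mem _ _ (R.rootFunction_mem_rootSpan hi))
    · by_cases hki : k = i
      · rw [hki]; exact hiK
      · obtain ⟨a, ha⟩ := hKr' k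
        rw [show R.rootFunction Q I k = R.rootFunction Q K k + a • R.rootFunction Q I i by
          rw [ha, sub_add_cancel]]
        exact add_mem (R.rootFunction_mem_rootSpan ((hKmem k).2 (Or.inr ⟨hki, hk⟩)))
          (Submodule.smul_mem _ _ hiK)
  have hstep : ∀ v, R.InChamber w v → ∀ k,
      inner ℝ v (R.weightFunction Q I k) ≤ inner ℝ v (R.weightFunction Q K k) := by
    intro v hv k
    obtain ⟨a, ha, hk⟩ := hKw k
    have h1 := hv _ hneg
    rw [rep_rep_inv, inner_neg_right] at h1
    rw [hk, inner_sub_right, real_inner_smul_right]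
    nlinarith
  have hρ : 0 < inner ℝ (R.rep w R.weightSum) (-R.rootFunction Q I i) := by
    rw [← R.rep_rep_inv w (-_), inner_rep]
    exact R.inner_weightSum_pos (rep_mem_roots (neg_mem_roots hroot) _) hneg
  have hρw : R.InChamber w (R.rep w R.weightSum) := by
    intro γ hγ
    rw [inner_rep, inner_weightSum]
    exact Finset.sum_nonneg fun s _ =>
      mul_nonneg (by have := R.inner_simpleRoot_self_pos s; positivity) (hγ s)
  have := hmax ⟨K, hK, hspanK.trans hspan, fun v hv k => (hle v hv k).trans (hstep v hv k)⟩
  refine absurd this (not_le.2 (Finset.sum_lt_sum (fun k _ => hstep _ hρw k)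
    ⟨k₀, Finset.mem_univ _, ?_⟩))
  rw [inner_neg_right] at hρ
  simp only
  rw [hk₀, inner_sub_right, real_inner_smul_right]
  nlinarith

/-- All facets have the same root span. -/
theorem rootSpan_eq (hI : cs.IsFacet Q I) (hJ : cs.IsFacet Q J) :
    R.rootSpan Q I = R.rootSpan Q J := by
  obtain ⟨I', hI', h1, -⟩ := R.exists_isGood 1 hI
  obtain ⟨J', hJ', h2, -⟩ := R.exists_isGood 1 hJ
  rw [← h1, ← h2, R.isGood_one_unique hI' hJ']

/-- The root configurations of all facets of `Q` are linearly independent. -/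
def IsRootIndependent (Q : List S) : Prop :=
  ∀ I, cs.IsFacet Q I → LinearIndependent ℝ fun i : I => R.rootFunction Q I i

variable {R}

/-- The sets `w(Φ⁺)` and `ws(Φ⁺)` differ only in `±w(α_s)`. Either the configuration avoids
`-w(α_s)` and `I` already suits `w`, or one flip at that root suffices; the data kept about the flip
allow `I` to be recovered from `J`. -/
theorem IsGood.of_mul_simple (hind : R.IsRootIndependent Q) {w : W} {s : S}
    (h : R.IsGood Q (w * cs.simple s) I) :
    (R.IsGood Q w I ∧ ∀ i ∈ I, R.rootFunction Q I i ≠ R.rep w (R.simpleRoot s)) ∨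
      ∃ i j J, R.IsGood Q w J ∧ j ∈ J ∧ R.rootFunction Q J j = R.rep w (R.simpleRoot s) ∧
        i ∉ J ∧ (R.rootFunction Q J i = R.rep w (R.simpleRoot s) ∨
          R.rootFunction Q J i = -R.rep w (R.simpleRoot s)) ∧
        ∀ k, k ∈ I ↔ k = i ∨ k ≠ j ∧ k ∈ J := by
  obtain ⟨hI, hpos⟩ := h
  simp only [mul_inv_rev, cs.inv_simple, rep_mul_apply] at hpos
  have hpos' : ∀ k ∈ I, R.rootFunction Q I k ≠ -R.rep w (R.simpleRoot s) →
      R.IsPos (R.rep w⁻¹ (R.rootFunction Q I k)) := by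
    intro k hk hne
    by_contra hn
    have hm := rep_mem_roots (rep_mem_roots (R.rootFunction_mem I k) w⁻¹) (cs.simple s)
    have := R.eq_simpleRoot_of_isPos (s := s) hm (hpos k hk) (by
      rwa [← rep_mul_apply, cs.simple_mul_simple_self, rep_one_apply])
    apply hne
    rw [← map_neg, ← R.rep_simple_self, ← this, ← rep_mul_apply _ (cs.simple s),
      cs.simple_mul_simple_self, rep_one_apply, rep_rep_inv]
  by_cases hex : ∃ i ∈ I, R.rootFunction Q I i = -R.rep w (R.simpleRoot s)
  · right
    obtain ⟨i, hi, hir⟩ := hex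
    obtain ⟨j, hj, J, hJ, hJmem, hJj, hJi, hJr, -⟩ := R.exists_flip hI hi
    have hij : i ≠ j := fun h => hj (h ▸ hi)
    rw [hir, neg_neg] at hJj
    have ht : cs.prefixProd Q I i * cs.simple (Q.get i) * (cs.prefixProd Q I i)⁻¹ =
        w * cs.simple s * w⁻¹ := R.conj_simple_eq_of_rep_eq (Or.inr hir)
    refine ⟨i, j, J, ⟨hJ, fun k hk => ?_⟩, (hJmem j).2 (Or.inl rfl), hJj,
      by simp [hJmem, hij], ?_, fun k => ?_⟩
    · rcases (hJmem k).1 hk with rfl | ⟨hki, hkI⟩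
      · rw [hJj, rep_inv_rep]; exact R.isPos_simpleRoot s
      · rcases hJr k with h1 | h1
        · rw [h1]
          refine hpos' k hkI fun h2 => hki ?_
          have := (hind I hI).injective (a₁ := ⟨k, hkI⟩) (a₂ := ⟨i, hi⟩) (h2.trans hir.symm)
          exact congrArg Subtype.val this
        · rw [h1, ht, rep_mul_apply, rep_mul_apply, rep_inv_rep]
          exact hpos k hkI
    · rw [hir, neg_neg] at hJi
      exact hJi.symm
    · by_cases hki : k = i
      · simp [hki, hi]
      · by_cases hkj : k = j
        · simp [hkj, hj, hij.symm]
        · simp [hJmem, hki, hkj]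
  · left
    push Not at hex
    refine ⟨⟨hI, fun k hk => hpos' k hk (hex k hk)⟩, fun i hi hir => ?_⟩
    have := hpos i hi
    rw [hir, rep_inv_rep, rep_simple_self] at this
    exact (R.isPos_simpleRoot s).not_neg (R.simpleRoot_mem s) this

theorem IsGood.unique (hind : R.IsRootIndependent Q) {w : W} (hI : R.IsGood Q w I)
    (hJ : R.IsGood Q w J) : I = J := by
  induction w using cs.simple_induction_right generalizing I J with
  | one => exact R.isGood_one_unique hI hJ
  | mul_simple_right w s ih =>
    rcases hI.of_mul_simple hind with ⟨hI', hIr⟩ | ⟨i, j, I', hI', hj, hjr, hi, hir, hII⟩ <;>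
    rcases hJ.of_mul_simple hind with ⟨hJ', hJr⟩ | ⟨i', j', J', hJ', hj', hjr', hi', hir', hJJ⟩
    · exact ih hI' hJ'
    · obtain rfl := ih hI' hJ'
      exact absurd hjr' (hIr j' hj')
    · obtain rfl := ih hI' hJ'
      exact absurd hjr (hJr j hj)
    · obtain rfl := ih hI' hJ'
      have hjj : j = j' := congrArg Subtype.val
        ((hind I' hI'.1).injective (a₁ := ⟨j, hj⟩) (a₂ := ⟨j', hj'⟩) (hjr.trans hjr'.symm))
      -- Roots at positions outside a facet are positive, so the two signs agree and injectivity
      -- applies.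
      have hii : i = i' := by
        have h1 := R.isPos_rootFunction hI'.1 hi
        have h2 := R.isPos_rootFunction hI'.1 hi'
        apply R.rootFunction_injOn hI'.1 hi hi'
        have hm := R.rootFunction_mem I' i
        rcases hir with h3 | h3 <;> rcases hir' with h4 | h4
        · rw [h3, h4]
        · rw [h4, ← h3] at h2
          exact absurd h2 (h1.not_neg hm)
        · rw [h4, ← neg_neg (R.rep w _), ← h3] at h2
          exact absurd h2 (h1.not_neg hm)
        · rw [h3, h4]
      subst hjj hii
      ext k
      rw [hII, hJJ]

/-- Every linear functional is maximized by a single facet on all weight functions. -/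
theorem exists_isFacet_inner_le (hind : R.IsRootIndependent Q) (hne : ∃ I, cs.IsFacet Q I)
    (v : V) : ∃ I, cs.IsFacet Q I ∧ ∀ J, cs.IsFacet Q J → ∀ k,
      inner ℝ v (R.weightFunction Q J k) ≤ inner ℝ v (R.weightFunction Q I k) := by
  obtain ⟨w, hw⟩ := R.exists_inChamber v
  obtain ⟨I₀, hI₀⟩ := hne
  obtain ⟨I, hI, -, -⟩ := R.exists_isGood w hI₀
  refine ⟨I, hI.1, fun J hJ k => ?_⟩
  obtain ⟨I', hI', -, h⟩ := R.exists_isGood w hJ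
  rw [hI.unique hind hI']
  exact h v hw k

/-- A linear functional that is positive on the root configuration of a facet is maximized by this
facet on all weight functions. -/
theorem inner_weightFunction_le (hind : R.IsRootIndependent Q) (hI : cs.IsFacet Q I) {v : V}
    (hv : ∀ i ∈ I, 0 < inner ℝ v (R.rootFunction Q I i)) (hJ : cs.IsFacet Q J)
    (k : Fin Q.length) :
    inner ℝ v (R.weightFunction Q J k) ≤ inner ℝ v (R.weightFunction Q I k) := by
  obtain ⟨w, hw⟩ := R.exists_inChamber v
  -- A root outside `w(Φ⁺)` would pair nonpositively with `v`.
  have hgood : R.IsGood Q w I := by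
    refine ⟨hI, fun i hi => ?_⟩
    by_contra hn
    have h1 := hw _ ((R.isPos_neg_iff (rep_mem_roots (R.rootFunction_mem I i) _)).2 hn)
    rw [map_neg, rep_rep_inv, inner_neg_right] at h1
    linarith [hv i hi]
  obtain ⟨I', hI', -, h⟩ := R.exists_isGood w hJ
  rw [hgood.unique hind hI']
  exact h v hw k

end CoxeterRootSystem

/-! ### The word `c c(w₀)`: its initial facet and independence of root configurations. -/

theorem lexFirst_spec {m : ℕ} {P : Finset (Fin m) → Prop} (h : ∃ I, P I) : P (lexFirst P) := by
  obtain ⟨I₀, hI₀⟩ := h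
  have : Nonempty {I // P I} := ⟨⟨I₀, hI₀⟩⟩
  obtain ⟨⟨I, hI⟩, hmin⟩ := Finite.exists_min fun I : {I // P I} => I.1.sort (· ≤ ·)
  exact (Classical.epsilon_spec (p := fun I => P I ∧ ∀ J, P J → I.sort (· ≤ ·) ≤ J.sort (· ≤ ·))
    ⟨I, hI, fun J hJ => hmin ⟨J, hJ⟩⟩).1

theorem subwordAt_map {S : Type*} (Q : List S) {n : ℕ} (f : Fin n ↪o Fin Q.length) :
    subwordAt Q (Finset.univ.map f.toEmbedding) = List.ofFn fun i => Q.get (f i) := by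
  have : (Finset.univ.map f.toEmbedding).sort (· ≤ ·) = List.ofFn f := by
    refine List.Perm.eq_of_pairwise' (Finset.pairwise_sort _ _) ?_ ?_
    · rw [List.pairwise_ofFn]
      exact fun i j hij => f.monotone hij.le
    · rw [List.perm_ext_iff_of_nodup (Finset.sort_nodup _ _) (List.nodup_ofFn.2 f.injective)]
      intro a
      simp [List.mem_ofFn]
  rw [subwordAt, this, List.map_ofFn]
  rfl

theorem subwordAt_univ {S : Type*} (Q : List S) : subwordAt Q Finset.univ = Q := by
  have h := subwordAt_map Q (RelEmbedding.refl _)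
  simp only [RelEmbedding.refl_apply, List.ofFn_get] at h
  convert h
  ext
  simp

theorem exists_subwordAt_eq {S : Type*} {ω Q : List S} (h : ω.Sublist Q) :
    ∃ J, subwordAt Q J = ω := by
  obtain ⟨f, hf⟩ := List.sublist_iff_exists_fin_orderEmbedding_get_eq.1 h
  refine ⟨_, (subwordAt_map Q f).trans ?_⟩
  simp only [← hf, List.ofFn_get]

theorem sublist_flatten_replicate {S : Type*} {c : List S} (hc : ∀ s, s ∈ c) (ω : List S) :
    ω.Sublist (List.replicate ω.length c).flatten := by
  induction ω with
  | nil => simp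
  | cons s ω ih =>
    rw [List.length_cons, List.replicate_succ, List.flatten_cons]
    exact (List.singleton_sublist.2 (hc s)).append ih

namespace CoxeterRootSystem

variable {S W : Type*} [Group W] {M : CoxeterMatrix S} {cs : CoxeterSystem M W}
  {V : Type*} [NormedAddCommGroup V] [InnerProductSpace ℝ V] (R : CoxeterRootSystem cs V)
  [Fintype S] [Finite W] {c : List S}

theorem finite_positiveRoots : R.positiveRoots.Finite := by
  refine (Set.finite_range fun p : W × S => R.rep p.1 (R.simpleRoot p.2)).subset ?_
  rintro _ ⟨⟨w, s, rfl⟩, -⟩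
  exact ⟨(w, s), rfl⟩

/-- A reduced word of `w₀`, with empty facet, crosses distinct positive roots. So `N` copies of `c`
contain such a word, one letter from each copy used. -/
theorem length_longest_le : cs.length cs.longest ≤ R.positiveRoots.ncard := by
  obtain ⟨ω, hω, h⟩ := cs.exists_isReduced cs.longest
  have hf : cs.IsFacet ω ∅ := by
    rw [CoxeterSystem.IsFacet, Finset.compl_empty, subwordAt_univ]
    exact ⟨hω, h.symm⟩
  have hinj : Function.Injective (R.rootFunction ω ∅) := fun i j hij =>
    R.rootFunction_injOn hf (by simp) (by simp) hij
  have hsub : Set.range (R.rootFunction ω ∅) ⊆ R.positiveRoots := by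
    rintro _ ⟨k, rfl⟩
    exact ⟨R.rootFunction_mem _ _, R.isPos_rootFunction hf (by simp)⟩
  have hle := Set.ncard_le_ncard hsub R.finite_positiveRoots
  rw [← Set.image_univ, Set.ncard_image_of_injective _ hinj, Set.ncard_univ, Nat.card_fin] at hle
  rwa [h, hω.eq]

theorem isReducedWordOfLongest_sortingWord (hc : ∀ s, s ∈ c) :
    cs.IsReducedWordOfLongest (R.sortingWord c) := by
  rw [sortingWord]
  apply lexFirst_spec (P := fun J => cs.IsReducedWordOfLongest (subwordAt _ J))
  obtain ⟨ω, hω, h⟩ := cs.exists_isReduced cs.longest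
  have hle : ω.length ≤ R.positiveRoots.ncard := by
    rw [← hω.eq, ← h]
    exact R.length_longest_le
  obtain ⟨J, hJ⟩ := exists_subwordAt_eq ((sublist_flatten_replicate hc ω).trans
    ((List.replicate_sublist_replicate c).2 hle).flatten)
  exact ⟨J, by rw [hJ]; exact ⟨hω, h.symm⟩⟩

/-- The initial copy of `c` in `c c(w₀)` is a facet. -/
theorem isFacet_word (hc : ∀ s, s ∈ c) : cs.IsFacet (R.word c)
    (Finset.univ.filter fun k : Fin (R.word c).length => k.val < c.length) := by
  have hlen : c.length + (R.sortingWord c).length = (R.word c).length :=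
    List.length_append.symm
  have h := subwordAt_map (R.word c)
    ((Fin.natAddOrderEmb c.length).trans (Fin.castOrderIso hlen).toOrderEmbedding)
  have h2 : (List.ofFn fun i => (R.word c).get
      (((Fin.natAddOrderEmb c.length).trans (Fin.castOrderIso hlen).toOrderEmbedding) i)) =
      R.sortingWord c := by
    conv_rhs => rw [← List.ofFn_get (R.sortingWord c)]
    congr 1
    funext i
    have key : ∀ h, (c ++ R.sortingWord c)[c.length + (i : ℕ)]'h = (R.sortingWord c)[(i : ℕ)] := by
      simp
    exact key _
  have h3 : (Finset.univ.filter fun k : Fin (R.word c).length => k.val < c.length)ᶜ =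
      Finset.univ.map ((Fin.natAddOrderEmb c.length).trans
        (Fin.castOrderIso hlen).toOrderEmbedding).toEmbedding := by
    ext k
    simp only [Finset.compl_filter, not_lt, Finset.mem_filter, Finset.mem_univ, true_and,
      Finset.mem_map]
    constructor
    · intro hk
      refine ⟨⟨k - c.length, by omega⟩, Fin.ext ?_⟩
      simp
      omega
    · rintro ⟨i, rfl⟩
      simp
  rw [CoxeterSystem.IsFacet, h3, h, h2]
  exact R.isReducedWordOfLongest_sortingWord hc

/-- The span may be computed on the initial copy of `c`, where all prefix products are trivial and
the roots are the simple ones. -/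
theorem rootSpan_word (hc : ∀ s, s ∈ c) {I : Finset (Fin (R.word c).length)}
    (hI : cs.IsFacet (R.word c) I) : R.rootSpan (R.word c) I = ⊤ := by
  rw [R.rootSpan_eq hI (R.isFacet_word hc), eq_top_iff, ← R.simpleRoot.span_eq]
  refine Submodule.span_mono ?_
  rintro _ ⟨s, rfl⟩
  obtain ⟨k, hk, rfl⟩ := List.mem_iff_getElem.1 (hc s)
  have hk' : k < (R.word c).length := by
    rw [word, List.length_append]
    omega
  refine ⟨⟨k, hk'⟩, by simpa using hk, ?_⟩
  rw [rootFunction_eq, CoxeterSystem.prefixProd, Finset.sdiff_eq_empty_iff_subset.2]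
  · rw [subwordAt, Finset.sort_empty, List.map_nil, cs.wordProd_nil, rep_one_apply]
    simp [word, List.getElem_append_left hk]
  · intro j
    simp only [Finset.mem_filter, Finset.mem_univ, true_and]
    omega

/-- The complement of a facet has as many letters as `c(w₀)`, so the facet has `n = dim V` elements,
and their roots span. -/
theorem isRootIndependent_word (hc : IsCoxeterWord c) : R.IsRootIndependent (R.word c) := by
  classical
  intro I hI
  refine linearIndependent_of_top_le_span_of_card_eq_finrank ?_ ?_
  · rw [← R.rootSpan_word hc.2 hI]
    refine Submodule.span_mono ?_
    rintro _ ⟨i, hi, rfl⟩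
    exact ⟨⟨i, hi⟩, rfl⟩
  · have h1 := hI.card_compl
    have h2 := R.isReducedWordOfLongest_sortingWord hc.2
    have h3 : (R.word c).length = c.length + (R.sortingWord c).length := List.length_append
    have h4 : c.length = Fintype.card S := by
      rw [← List.toFinset_card_of_nodup hc.1, ← Finset.card_univ]
      congr 1
      ext s
      simp [hc.2 s]
    have h5 := Finset.card_add_card_compl I
    rw [← h2.2, h2.1.eq] at h1
    rw [Fintype.card_fin] at h5
    rw [Module.finrank_eq_card_basis R.simpleRoot, Fintype.card_coe]
    omega

variable {R}

/-- As a function of the facet, a shifted weight is a translate of the weight function at one fixed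
position or is constantly the default `0`; simultaneous maximization passes to it either way. -/
theorem shiftedWeight_eq_or_eq_zero (R : CoxeterRootSystem cs V) (c : List S) (β : V) :
    (∃ k, ∀ I, R.shiftedWeight c I β = R.weightFunction (R.word c) I k -
      R.weightFunction (R.word c) (cs.antigreedy (R.word c)) k) ∨
    ∀ I, R.shiftedWeight c I β = 0 := by
  by_cases h : ∃ k : Fin (R.word c).length,
      c.length ≤ k ∧ R.rootFunction (R.word c) (cs.greedy (R.word c)) k = β
  · exact Or.inl ⟨h.choose, fun I => by rw [shiftedWeight, dif_pos h]⟩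
  · exact Or.inr fun I => by rw [shiftedWeight, dif_neg h]

theorem inner_shiftedWeight_le {v : V} {I J : Finset (Fin (R.word c).length)}
    (h : ∀ k, inner ℝ v (R.weightFunction (R.word c) J k) ≤
      inner ℝ v (R.weightFunction (R.word c) I k)) (β : V) :
    inner ℝ v (R.shiftedWeight c J β) ≤ inner ℝ v (R.shiftedWeight c I β) := by
  rcases R.shiftedWeight_eq_or_eq_zero c β with ⟨k, hk⟩ | h0
  · rw [hk, hk, inner_sub_right, inner_sub_right]
    exact sub_le_sub_right (h k) _
  · rw [h0, h0]

end CoxeterRootSystem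

/-! ### Convex geometry and conclusion. -/

/-- If each linear functional is maximized simultaneously on several families of points by a common
index, then the convex hull of the sums of the points is the Minkowski sum of the convex hulls. -/
theorem convexHull_sum_eq_of_exists_max {V ι α : Type*} [NormedAddCommGroup V]
    [InnerProductSpace ℝ V] [CompleteSpace V] [Finite ι] {p : ι → Prop} (X : Finset α)
    (g : ι → α → V) (h : ∀ v, ∃ i, p i ∧ ∀ j, p j → ∀ β ∈ X,
      inner ℝ v (g j β) ≤ inner ℝ v (g i β)) :
    convexHull ℝ {v | ∃ i, p i ∧ v = ∑ β ∈ X, g i β} =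
      ∑ β ∈ X, convexHull ℝ {v | ∃ i, p i ∧ v = g i β} := by
  rw [← convexHull_sum]
  apply Set.Subset.antisymm
  · refine convexHull_mono ?_
    rintro _ ⟨i, hi, rfl⟩
    exact Set.finsetSum_mem_finsetSum _ _ _ fun β _ => ⟨i, hi, rfl⟩
  · refine convexHull_min (fun x hx => ?_) (convex_convexHull ℝ _)
    obtain ⟨y, hy, rfl⟩ := (Set.mem_finsetSum _ _ _).1 hx
    -- A functional separating the sum from the hull contradicts its common maximizer, which
    -- dominates every summand.
    by_contra hnot
    have hfin : {v | ∃ i, p i ∧ v = ∑ β ∈ X, g i β}.Finite := by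
      refine (Set.finite_range fun i => ∑ β ∈ X, g i β).subset ?_
      rintro _ ⟨i, -, rfl⟩
      exact ⟨i, rfl⟩
    obtain ⟨f, u, hfu, huf⟩ := geometric_hahn_banach_closed_point (convex_convexHull ℝ _)
      (hfin.isClosed_convexHull ℝ) hnot
    obtain ⟨v, rfl⟩ := (InnerProductSpace.toDual ℝ V).surjective f
    obtain ⟨i, hi, hmax⟩ := h v
    have h1 := hfu _ (subset_convexHull ℝ _ ⟨i, hi, rfl⟩)
    simp only [InnerProductSpace.toDual_apply_apply, inner_sum] at h1 huf
    refine absurd (huf.trans_le (Finset.sum_le_sum fun β hβ => ?_)) h1.not_gt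
    obtain ⟨j, hj, hjy⟩ := hy hβ
    rw [hjy]
    exact hmax j hj β hβ

/-- A point that maximizes an open set of linear functionals is extreme. -/
theorem mem_extremePoints_convexHull_of_isOpen {V : Type*} [NormedAddCommGroup V]
    [InnerProductSpace ℝ V] {A U : Set V} {x : V} (hx : x ∈ A) (hU : IsOpen U)
    (hne : U.Nonempty) (h : ∀ v ∈ U, ∀ y ∈ A, inner ℝ v y ≤ inner ℝ v x) :
    x ∈ (convexHull ℝ A).extremePoints ℝ := by
  have hle : ∀ v ∈ U, ∀ y ∈ convexHull ℝ A, inner ℝ v y ≤ inner ℝ v x := by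
    intro v hv y hy
    exact convexHull_min (t := {y | inner ℝ v y ≤ inner ℝ v x}) (h v hv)
      (convex_halfSpace_le (f := fun y => inner ℝ v y)
        ⟨fun _ _ => inner_add_right _ _ _, fun _ _ => real_inner_smul_right _ _ _⟩ _) hy
  -- Moving a point of `U` slightly in the direction `z` stays in `U`, which forces `⟨z, z⟩ = 0`.
  have hzero : ∀ z, (∀ v ∈ U, inner ℝ v z = 0) → z = 0 := by
    intro z hz
    obtain ⟨v, hv⟩ := hne
    have hcont : Continuous fun t : ℝ => v + t • z := by fun_prop
    have hmem : (fun t : ℝ => v + t • z) ⁻¹' U ∈ nhds (0 : ℝ) :=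
      (hU.preimage hcont).mem_nhds (by simpa using hv)
    obtain ⟨ε, hε, hball⟩ := Metric.mem_nhds_iff.1 hmem
    have h1 := hz _ (hball (show ε / 2 ∈ Metric.ball (0 : ℝ) ε by
      rw [Metric.mem_ball, Real.dist_eq, sub_zero, abs_of_pos (by positivity)]; linarith))
    rw [inner_add_left, hz v hv, zero_add, real_inner_smul_left] at h1
    exact inner_self_eq_zero.1 ((mul_eq_zero.1 h1).resolve_left (by positivity))
  rw [mem_extremePoints]
  refine ⟨subset_convexHull ℝ _ hx, ?_⟩
  rintro y hy z hz ⟨a, b, ha, hb, hab, hyz⟩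
  -- A maximum attained inside a segment is attained at both of its ends.
  have heq : ∀ v ∈ U, inner ℝ v (y - x) = 0 ∧ inner ℝ v (z - x) = 0 := by
    intro v hv
    have h1 := hle v hv y hy
    have h2 := hle v hv z hz
    have h3 : a * inner ℝ v y + b * inner ℝ v z = inner ℝ v x := by
      rw [← hyz, inner_add_right, real_inner_smul_right, real_inner_smul_right]
    obtain rfl : b = 1 - a := by linarith
    rw [inner_sub_right, inner_sub_right]
    constructor <;> nlinarith
  exact ⟨sub_eq_zero.1 (hzero _ fun v hv => (heq v hv).1),
    sub_eq_zero.1 (hzero _ fun v hv => (heq v hv).2)⟩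

/-- Supplies a point of the open cone of functionals positive on a root configuration. -/
theorem LinearIndependent.exists_inner_eq_one {V ι : Type*} [NormedAddCommGroup V]
    [InnerProductSpace ℝ V] [FiniteDimensional ℝ V] {b : ι → V} (hb : LinearIndependent ℝ b) :
    ∃ v, ∀ i, inner ℝ v (b i) = 1 := by
  have : CompleteSpace V := FiniteDimensional.complete ℝ V
  obtain ⟨f, hf⟩ := LinearMap.exists_extend
    (Finsupp.linearCombination ℝ (fun _ : ι => (1 : ℝ)) ∘ₗ hb.repr)
  refine ⟨(InnerProductSpace.toDual ℝ V).symm (LinearMap.toContinuousLinearMap f), fun i => ?_⟩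
  rw [InnerProductSpace.toDual_symm_apply]
  have h := LinearMap.congr_fun hf ⟨b i, Submodule.subset_span ⟨i, rfl⟩⟩
  rw [LinearMap.comp_apply, LinearMap.comp_apply, hb.repr_eq_single i ⟨b i, _⟩ rfl] at h
  simpa using h

theorem mainTheorem5 {S W V : Type*} [Fintype S] [Group W] [Finite W] {M : CoxeterMatrix S}
    (cs : CoxeterSystem M W) [NormedAddCommGroup V] [InnerProductSpace ℝ V]
    (R : CoxeterRootSystem cs V) (c : List S) (hc : IsCoxeterWord c)
    (X : Finset V) (hX : (X : Set V) ⊆ R.positiveRoots) :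
    R.assoSet c X = ∑ β ∈ X, R.assoRoot c β ∧
      (R.assoSet c X).extremePoints ℝ =
        {v | ∃ I, cs.IsFacet (R.word c) I ∧ v = R.partialBrickVector c X I} := by
  have : FiniteDimensional ℝ V := R.simpleRoot.finiteDimensional_of_finite
  have : CompleteSpace V := FiniteDimensional.complete ℝ V
  have hind := R.isRootIndependent_word hc
  constructor
  · refine convexHull_sum_eq_of_exists_max X (R.shiftedWeight c) fun v => ?_
    obtain ⟨I, hI, hmax⟩ :=
      CoxeterRootSystem.exists_isFacet_inner_le hind ⟨_, R.isFacet_word hc.2⟩ v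
    exact ⟨I, hI, fun J hJ β _ => CoxeterRootSystem.inner_shiftedWeight_le (hmax J hJ) β⟩
  · refine Set.Subset.antisymm extremePoints_convexHull_subset ?_
    rintro _ ⟨I, hI, rfl⟩
    refine mem_extremePoints_convexHull_of_isOpen
      (U := ⋂ i ∈ I, {v | 0 < inner ℝ v (R.rootFunction (R.word c) I i)}) ⟨I, hI, rfl⟩ ?_ ?_ ?_
    · exact isOpen_biInter_finset fun i _ => isOpen_lt continuous_const (by fun_prop)
    · obtain ⟨v, hv⟩ := (hind I hI).exists_inner_eq_one
      refine ⟨v, Set.mem_iInter₂.2 fun i hi => ?_⟩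
      have := hv ⟨i, hi⟩
      simp only at this
      simp [this]
    · rintro v hv _ ⟨J, hJ, rfl⟩
      rw [CoxeterRootSystem.partialBrickVector, CoxeterRootSystem.partialBrickVector, inner_sum,
        inner_sum]
      exact Finset.sum_le_sum fun β _ => CoxeterRootSystem.inner_shiftedWeight_le
        (CoxeterRootSystem.inner_weightFunction_le hind hI (Set.mem_iInter₂.1 hv) hJ) β
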